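/- **Notation.** All spaces are over a fixed scalar field $\mathbb{R}$ or $\mathbb{C}$. For $0<p\le\infty$ let $\|\cdot\|_p$ denote the usual $\ell_p$ (quasi-)norm of scalar sequences. Let $X,Y$ be Banach spaces and $0<s\le 2$. A bounded operator $T:X\to Y$ is called *$(s;2)$-nuclear*, $T\in N_{s;2}(X,Y)$, if $$Tx=\sum_{n=1}^{\infty}a_n\langle x_n',x\rangle y_n\qquad (x\in X)$$ for some $x_n'\in X^*$ with $\|x_n'\|\le 1$, some scalars $(a_n)\in \ell_s$, and some $y_n\in Y$ with $$\|(y_n)\|_2^{\mathrm{weak}}:=\sup_{\|y'\|\le 1}\Big(\sum_n|\langle y',y_n\rangle|^2\Big)^{1/2}<\infty .$$ Let $\nu_{s;2}(T)$ be the infimum of $\|(a_n)\|_s$ over all such representations with $\|(y_n)\|_2^{\mathrm{weak}}\le 1$. For a Hilbert space $H$ and $0<p\le\infty$, the Schatten class $S_p(H)$ consists of the compact operators $U:H\to H$ whose sequence of singular numbers $(\mu_n(U))$ (the eigenvalues of $|U|=(U^*U)^{1/2}$ in decreasing order, counted with multiplicity, and followed by zeros if there are only finitely many) lies in $\ell_p$;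 put $\sigma_p(U)=\|(\mu_n(U))\|_p$. Thus $S_\infty(H)$ is the class of compact operators with the operator norm. An operator $T:X\to Y$ *factors through an operator in $S_p(H)$* if $T=BUA$ for some Hilbert space $H$, some bounded $A:X\to H$ and $B:H\to Y$, and some $U\in S_p(H)$; then $\gamma_{S_p}(T):=\inf\|A\|\,\sigma_p(U)\,\|B\|$, where the infimum is over all such factorizations. **Theorem.** Let $m\ge 1$, let $X_1,\dots,X_{m+1}$ be Banach spaces, let $0<s_k\le 2$ and $T_k\in N_{s_k;2}(X_k,X_{k+1})$ for $k=1,\dots,m$. Define $s\in(0,\infty]$ by $$\frac1s=\sum_{k=1}^m\frac1{s_k}-\frac12$$ (so $s=\infty$ exactly when $m=1$ and $s_1=2$). Then the product $T:=T_mT_{m-1}\cdots T_1$ factors through an operator in $S_s(H)$, and $$\gamma_{S_s}(T)\le\prod_{k=1}^m\nu_{s_k;2}(T_k).$$ -/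

import Mathlib

open scoped ENNReal

universe u v

noncomputable section

namespace SchattenFactorization

/-- The `ℓ_p` quasi-norm of a scalar sequence, for `0 < p ≤ ∞`, with value `∞` exactly when the
sequence is not in `ℓ_p`. -/
def ellNorm {𝕜 : Type u} [RCLike 𝕜] (p : ℝ≥0∞) (a : ℕ → 𝕜) : ℝ≥0∞ :=
  if p = ∞ then ⨆ n, ‖a n‖ₑ else (∑' n, ‖a n‖ₑ ^ p.toReal) ^ (1 / p.toReal)

section Nuclear

variable {𝕜 : Type u} [RCLike 𝕜] {X Y : Type v}
  [NormedAddCommGroup X] [NormedSpace 𝕜 X] [NormedAddCommGroup Y] [NormedSpace 𝕜 Y]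

/-- The weak `ℓ_2` norm `sup { (∑ |⟨y', y_n⟩|²)^{1/2} : ‖y'‖ ≤ 1 }` of a sequence of vectors. -/
def weakEllTwoNorm (𝕜 : Type u) [RCLike 𝕜] {Y : Type v} [NormedAddCommGroup Y] [NormedSpace 𝕜 Y]
    (y : ℕ → Y) : ℝ≥0∞ :=
  ⨆ (φ : StrongDual 𝕜 Y) (_ : ‖φ‖ ≤ 1), ellNorm 2 (fun n => φ (y n))

/-- `T x = ∑ a_n ⟨x'_n, x⟩ y_n` for all `x`, with functionals `x'_n` in the unit ball. -/
def Represents (T : X →L[𝕜] Y) (a : ℕ → 𝕜) (x' : ℕ → StrongDual 𝕜 X) (y : ℕ → Y) : Prop :=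
  (∀ n, ‖x' n‖ ≤ 1) ∧ ∀ x, HasSum (fun n => (a n * x' n x) • y n) (T x)

/-- The class `N_{s;2}(X, Y)` of `(s;2)`-nuclear operators. -/
def IsNuclear (s : ℝ≥0∞) (T : X →L[𝕜] Y) : Prop :=
  ∃ (a : ℕ → 𝕜) (x' : ℕ → StrongDual 𝕜 X) (y : ℕ → Y),
    Represents T a x' y ∧ ellNorm s a < ∞ ∧ weakEllTwoNorm 𝕜 y < ∞

/-- The quasi-norm `ν_{s;2}(T)`: the infimum of `‖(a_n)‖_s` over the representations of `T`
that are normalized by `‖(y_n)‖_2^weak ≤ 1`. -/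
def nu (s : ℝ≥0∞) (T : X →L[𝕜] Y) : ℝ≥0∞ :=
  sInf {c | ∃ (a : ℕ → 𝕜) (x' : ℕ → StrongDual 𝕜 X) (y : ℕ → Y),
    Represents T a x' y ∧ weakEllTwoNorm 𝕜 y ≤ 1 ∧ c = ellNorm s a}

end Nuclear

section Schatten

variable {𝕜 : Type u} [RCLike 𝕜] {H : Type v}
  [NormedAddCommGroup H] [InnerProductSpace 𝕜 H] [CompleteSpace H]

/-- The singular numbers of a (compact) operator `U`, numbered from `0`: the `n`-th one is the
`(n+1)`-st largest eigenvalue of `|U| = (U* U)^{1/2}`, counted with multiplicity, that is, the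
largest `c ≥ 0` for which there are `n + 1` orthonormal eigenvectors of `U* U` with eigenvalues
`t² ≥ c²` (and `0` if the dimension is at most `n`). -/
def singularNumber (U : H →L[𝕜] H) (n : ℕ) : ℝ :=
  sSup {c : ℝ | 0 ≤ c ∧ ∃ e : Fin (n + 1) → H, Orthonormal 𝕜 e ∧
    ∀ i, ∃ t : ℝ, c ≤ t ∧ (ContinuousLinearMap.adjoint U) (U (e i)) = ((t ^ 2 : ℝ) : 𝕜) • e i}

/-- The Schatten quasi-norm `σ_p(U)`, the `ℓ_p` quasi-norm of the singular numbers. -/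
def sigma (p : ℝ≥0∞) (U : H →L[𝕜] H) : ℝ≥0∞ :=
  ellNorm p (singularNumber U)

/-- The Schatten class `S_p(H)`, `0 < p ≤ ∞`. For `p = ∞` these are the compact operators. -/
def IsSchatten (p : ℝ≥0∞) (U : H →L[𝕜] H) : Prop :=
  IsCompactOperator U ∧ sigma p U < ∞

end Schatten

section Factorization

variable {𝕜 : Type u} [RCLike 𝕜] {X Y : Type v}
  [NormedAddCommGroup X] [NormedSpace 𝕜 X] [NormedAddCommGroup Y] [NormedSpace 𝕜 Y]

/-- `T = B U A` for some Hilbert space `H` and some `A : X → H`, `U ∈ S_p(H)`, `B : H → Y`. -/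
def FactorsThroughSchatten (p : ℝ≥0∞) (T : X →L[𝕜] Y) : Prop :=
  ∃ (H : Type (max u v)) (_ : NormedAddCommGroup H) (_ : InnerProductSpace 𝕜 H)
    (_ : CompleteSpace H) (A : X →L[𝕜] H) (U : H →L[𝕜] H) (B : H →L[𝕜] Y),
    IsSchatten p U ∧ T = B ∘L U ∘L A

/-- The quasi-norm `γ_{S_p}(T) = inf ‖A‖ σ_p(U) ‖B‖` over all factorizations `T = B U A` through
an operator `U` of class `S_p` (`∞` if there are none). -/
def gammaSchatten (p : ℝ≥0∞) (T : X →L[𝕜] Y) : ℝ≥0∞ :=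
  sInf {c | ∃ (H : Type (max u v)) (_ : NormedAddCommGroup H) (_ : InnerProductSpace 𝕜 H)
    (_ : CompleteSpace H) (A : X →L[𝕜] H) (U : H →L[𝕜] H) (B : H →L[𝕜] Y),
    IsSchatten p U ∧ T = B ∘L U ∘L A ∧ c = ‖A‖ₑ * sigma p U * ‖B‖ₑ}

end Factorization

/-- The partial product `T_{k-1} ⋯ T_1 T_0 : X_0 → X_k` of a chain `T_k : X_k → X_{k+1}`
(indices from `0`). -/
def chainProd {𝕜 : Type u} [RCLike 𝕜] {m : ℕ} {X : Fin (m + 1) → Type v}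
    [∀ k, NormedAddCommGroup (X k)] [∀ k, NormedSpace 𝕜 (X k)]
    (T : ∀ k : Fin m, X k.castSucc →L[𝕜] X k.succ) (k : Fin (m + 1)) : X 0 →L[𝕜] X k :=
  Fin.induction (motive := fun k => X 0 →L[𝕜] X k) (ContinuousLinearMap.id 𝕜 (X 0))
    (fun k P => (T k).comp P) k

end SchattenFactorization

end

noncomputable section

/-! Put `τ_k = 1/s_k ≥ 1/2`. A nuclear operator is a synthesis map from `ℓ_2` after a diagonal
operator `a^(τ-1/2)` after `x ↦ (a_n^(1/2) φ_n x)`, with `∑ a_n < 1`. So a single operator factors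
through a diagonal whose exponent is `τ - 1/2`: half a power is spent on entering `ℓ_2` from a
Banach space. Each later operator is met from a Hilbert space, where its analysis part is
Hilbert–Schmidt and that half power counts as well. The exponents add up to `∑ τ_k - 1/2 = 1/s`.

The invariant is `DiagFactor t C`: `C` times contractions around a diagonal operator with entries at
most `z_i^t`, `∑ z_i ≤ 1`. Composition preserves it with constant exactly one. Composing on the left
with an operator `R` for which `‖R B e_i‖ ≤ w_i^τ` bounds the images of the unit vectors by
`q_i^(t+τ)` (weighted arithmetic–geometric mean). The singular value decomposition turns this into a
new diagonal, because `∑ ‖V f_j‖^p ≤ ∑ ‖V e_i‖^p` for `p ≤ 2` when the `f_j` form a Hilbert basis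
with orthogonal images (`exists_diag_factorization`). Jensen's inequality handles diagonal operators
with exponent at most `1/2`; larger exponents are split into such pieces.

For exponent zero the bound `z^t` gives no decay, so compactness is obtained separately, by moving
slowly growing weights from the diagonal to the analysis map. Finally, the singular numbers of a
diagonal operator are matched injectively with its entries by Hall's theorem. -/

namespace SchattenFactorization

open Filter Topology
open scoped NNReal InnerProductSpace

/-! ### Inequalities for sequences in the unit ball of `ℓ_1`. -/

/-- Jensen's inequality for the concave power `x ^ θ` and a family of weights of mass at most one. -/
theorem tsum_mul_rpow_le {ι : Type*} (w x : ι → ℝ≥0∞) (hw : ∑' i, w i ≤ 1) {θ : ℝ} (h0 : 0 ≤ θ)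
    (h1 : θ ≤ 1) : ∑' i, w i * x i ^ θ ≤ (∑' i, w i * x i) ^ θ := by
  obtain rfl | h0 := h0.eq_or_lt
  · simpa using hw
  rw [ENNReal.tsum_eq_iSup_sum]
  refine iSup_le fun s => ?_
  have h := ENNReal.inner_le_weight_mul_Lp_of_nonneg s ((one_le_inv₀ h0).2 h1) w (fun i => x i ^ θ)
  simp only [ENNReal.rpow_rpow_inv h0.ne', inv_inv] at h
  refine h.trans ?_
  have hs : (∑ i ∈ s, w i) ^ (1 - θ) ≤ 1 :=
    ENNReal.rpow_le_one ((ENNReal.sum_le_tsum s).trans hw) (by linarith)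
  calc _ ≤ 1 * (∑ i ∈ s, w i * x i) ^ θ := by gcongr
    _ ≤ _ := by
      rw [one_mul]
      exact ENNReal.rpow_le_rpow (ENNReal.sum_le_tsum s) h0.le

theorem le_one_of_tsum_le_one {ι : Type*} {u : ι → ℝ≥0∞} (hu : ∑' i, u i ≤ 1) (i : ι) : u i ≤ 1 :=
  (ENNReal.le_tsum i).trans hu

/-- Hölder's inequality for sequences dominated by powers of summable sequences. -/
theorem exists_rpow_mul_rpow_le {ι : Type*} {u w : ι → ℝ≥0∞} (hu : ∑' i, u i ≤ 1)
    (hw : ∑' i, w i ≤ 1) {t τ : ℝ} (ht : 0 ≤ t) (hτ : 0 ≤ τ) (h : 0 < t + τ) :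
    ∃ z : ι → ℝ≥0∞, ∑' i, z i ≤ 1 ∧ ∀ i, u i ^ t * w i ^ τ ≤ z i ^ (t + τ) := by
  obtain ⟨a, ha⟩ : ∃ a : ℝ≥0, (a : ℝ) = t / (t + τ) := ⟨⟨_, by positivity⟩, rfl⟩
  obtain ⟨b, hb⟩ : ∃ b : ℝ≥0, (b : ℝ) = τ / (t + τ) := ⟨⟨_, by positivity⟩, rfl⟩
  have hab : a + b = 1 := by
    ext
    rw [NNReal.coe_add, ha, hb, NNReal.coe_one]
    field_simp
  refine ⟨fun i => a * u i + b * w i, ?_, fun i => ?_⟩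
  · rw [ENNReal.tsum_add, ENNReal.tsum_mul_left, ENNReal.tsum_mul_left]
    calc _ ≤ (a : ℝ≥0∞) * 1 + b * 1 := by gcongr
      _ = 1 := by rw [mul_one, mul_one, ← ENNReal.coe_add, hab, ENNReal.coe_one]
  · have hui := ((le_one_of_tsum_le_one hu i).trans_lt ENNReal.one_lt_top).ne
    have hwi := ((le_one_of_tsum_le_one hw i).trans_lt ENNReal.one_lt_top).ne
    dsimp only
    generalize u i = x at hui ⊢
    generalize w i = y at hwi ⊢
    lift x to ℝ≥0 using hui
    lift y to ℝ≥0 using hwi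
    have key := NNReal.geom_mean_le_arith_mean2_weighted a b x y hab
    have key' : (x : ℝ≥0∞) ^ (a : ℝ) * (y : ℝ≥0∞) ^ (b : ℝ) ≤ a * x + b * y := by
      rw [← ENNReal.coe_rpow_of_nonneg _ a.coe_nonneg, ← ENNReal.coe_rpow_of_nonneg _ b.coe_nonneg]
      exact_mod_cast key
    have h2 := ENNReal.rpow_le_rpow key' h.le
    rw [ENNReal.mul_rpow_of_nonneg _ _ h.le, ← ENNReal.rpow_mul, ← ENNReal.rpow_mul] at h2
    have e1 : (a : ℝ) * (t + τ) = t := by rw [ha]; field_simp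
    have e2 : (b : ℝ) * (t + τ) = τ := by rw [hb]; field_simp
    rwa [e1, e2] at h2

/-- A sequence of sum less than one can be multiplied by weights tending to infinity so slowly that
the sum is still at most one. -/
theorem exists_weights_tendsto_atTop {u : ℕ → ℝ≥0∞} (hu : ∑' n, u n < 1) :
    ∃ w : ℕ → ℝ≥0, (∀ n, 1 ≤ w n) ∧ Tendsto w atTop atTop ∧ ∑' n, u n * w n ≤ 1 := by
  set δ : ℝ≥0∞ := 1 - ∑' n, u n with hδ
  have hδ0 : 0 < δ := tsub_pos_iff_lt.2 hu
  obtain ⟨ε, hε0, hε⟩ := ENNReal.exists_pos_sum_of_countable' hδ0.ne' ℕ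
  have htail := ENNReal.tendsto_sum_nat_add u (hu.trans ENNReal.one_lt_top).ne
  have hm : ∀ j : ℕ, ∃ m, j ≤ m ∧ ∑' k, u (k + m) ≤ ε j := fun j =>
    ((eventually_ge_atTop j).and (htail.eventually (Iic_mem_nhds (hε0 j)))).exists
  choose m hjm hm using hm
  -- The weight `1 + c n` counts the thresholds `m j` passed by `n`; `j ≤ m j` makes the count
  -- finite. Exchanging sums, the extra mass is the sum over `j` of the tails from `m j`, at most `∑
  -- ε j < δ`.
  set c : ℕ → ℕ := fun n => ((Finset.range (n + 1)).filter fun j => m j ≤ n).card with hc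
  refine ⟨fun n => 1 + (c n : ℝ≥0), fun n => le_self_add, ?_, ?_⟩
  · refine tendsto_atTop_mono (fun n => le_add_self)
      ((tendsto_natCast_atTop_atTop (R := ℝ≥0)).comp ?_)
    refine tendsto_atTop.2 fun J => ?_
    filter_upwards [eventually_ge_atTop (∑ j ∈ Finset.range J, m j)] with n hn
    have hmn : ∀ j ∈ Finset.range J, m j ≤ n := fun j hj =>
      (Finset.single_le_sum (f := m) (fun _ _ => Nat.zero_le _) hj).trans hn
    calc J = (Finset.range J).card := (Finset.card_range J).symm
      _ ≤ c n := Finset.card_le_card fun j hj => by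
        have := hmn j hj
        have := hjm j
        simp only [Finset.mem_filter, Finset.mem_range]
        omega
  · have hcount : ∀ n, ((c n : ℝ≥0) : ℝ≥0∞) = ∑' j, if m j ≤ n then (1 : ℝ≥0∞) else 0 := fun n => by
      rw [tsum_eq_sum (s := Finset.range (n + 1)), Finset.sum_boole]
      · simp [hc]
      · intro j hj
        have := hjm j
        simp only [Finset.mem_range] at hj
        rw [if_neg (by omega)]
    have hsplit : ∀ n, u n * ((1 + c n : ℝ≥0) : ℝ≥0∞) =
        u n + ∑' j, if m j ≤ n then u n else 0 := fun n => by
      rw [ENNReal.coe_add, hcount, mul_add, ENNReal.coe_one, mul_one, ← ENNReal.tsum_mul_left]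
      simp
    simp_rw [hsplit]
    rw [ENNReal.tsum_add, ENNReal.tsum_comm]
    have hj : ∀ j, (∑' n, if m j ≤ n then u n else 0) ≤ ε j := fun j => by
      refine le_trans (le_of_eq ?_) (hm j)
      rw [← ENNReal.summable.sum_add_tsum_nat_add' (k := m j) (f := fun n => if m j ≤ n then u n else 0)]
      simp only [le_add_iff_nonneg_left, zero_le, if_true]
      rw [Finset.sum_eq_zero, zero_add]
      intro n hn
      rw [if_neg (by simpa using hn)]
    calc _ ≤ ∑' n, u n + ∑' j, ε j := by gcongr with j; exact hj j
      _ ≤ ∑' n, u n + δ := by gcongr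
      _ = 1 := add_tsub_cancel_of_le hu.le

/-! ### Analysis, synthesis and diagonal operators on `ℓ_2(ι)`. -/

/-- The Hilbert space `ℓ_2(ι)`. -/
abbrev EllTwo (𝕜 : Type*) [RCLike 𝕜] (ι : Type*) := lp (fun _ : ι => 𝕜) 2

section EllTwo

variable {𝕜 : Type*} [RCLike 𝕜] {ι : Type*}

theorem enorm_sq_eq_tsum (x : EllTwo 𝕜 ι) : ‖x‖ₑ ^ 2 = ∑' i, ‖x i‖ₑ ^ 2 := by
  have h := lp.hasSum_norm (p := 2) (by norm_num) x
  simp only [ENNReal.toReal_ofNat, Real.rpow_two] at h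
  rw [← ofReal_norm, ← ENNReal.ofReal_pow (norm_nonneg _), ← h.tsum_eq,
    ENNReal.ofReal_tsum_of_nonneg (fun _ => by positivity) h.summable]
  simp_rw [ENNReal.ofReal_pow (norm_nonneg _), ofReal_norm]

theorem memℓp_two_of_tsum_ne_top {f : ι → 𝕜} (h : ∑' i, ‖f i‖ₑ ^ 2 ≠ ∞) : Memℓp f 2 := by
  refine memℓp_gen ?_
  convert! ENNReal.summable_toReal h using 2 with i
  simp

theorem sum_norm_sq_le_one {E : Type*} [NormedAddCommGroup E] {f : ι → E}
    (h : ∑' i, ‖f i‖ₑ ^ 2 ≤ 1) (s : Finset ι) : ∑ i ∈ s, ‖f i‖ ^ 2 ≤ 1 := by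
  have := (ENNReal.sum_le_tsum (f := fun i => ‖f i‖ₑ ^ 2) s).trans h
  simp_rw [← ofReal_norm, ← ENNReal.ofReal_pow (norm_nonneg _)] at this
  rwa [← ENNReal.ofReal_sum_of_nonneg fun _ _ => by positivity, ENNReal.ofReal_le_one] at this

theorem norm_le_mul_norm {x y : EllTwo 𝕜 ι} {c : ℝ} (hc : 0 ≤ c) (h : ∀ i, ‖y i‖ ≤ c * ‖x i‖) :
    ‖y‖ ≤ c * ‖x‖ := by
  have : ‖y‖ ≤ ‖((c : ℝ) : 𝕜) • x‖ := lp.norm_mono (by norm_num) fun i => by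
    rw [lp.coeFn_smul, Pi.smul_apply, norm_smul, RCLike.norm_ofReal, abs_of_nonneg hc]
    exact h i
  rwa [norm_smul, RCLike.norm_ofReal, abs_of_nonneg hc] at this

/-- The operator `x ↦ (φ_i(x))_i` into `ℓ_2`. -/
def analysis {X : Type*} [NormedAddCommGroup X] [NormedSpace 𝕜 X] (φ : ι → StrongDual 𝕜 X)
    (h : ∀ x, ∑' i, ‖φ i x‖ₑ ^ 2 ≤ ‖x‖ₑ ^ 2) : X →L[𝕜] EllTwo 𝕜 ι :=
  LinearMap.mkContinuous
    { toFun := fun x => ⟨fun i => φ i x, memℓp_two_of_tsum_ne_top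
        ((h x).trans_lt (ENNReal.pow_lt_top enorm_lt_top)).ne⟩
      map_add' := fun x y => by ext i; simp; rfl
      map_smul' := fun c x => by ext i; simp } 1 fun x => by
    rw [one_mul, ← enorm_le_iff_norm_le, ← ENNReal.pow_le_pow_left_iff two_ne_zero]
    exact (enorm_sq_eq_tsum _).trans_le (h x)

section Analysis

variable {X : Type*} [NormedAddCommGroup X] [NormedSpace 𝕜 X] (φ : ι → StrongDual 𝕜 X)
  (h : ∀ x, ∑' i, ‖φ i x‖ₑ ^ 2 ≤ ‖x‖ₑ ^ 2)

@[simp]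
theorem analysis_apply (x : X) (i : ι) : analysis φ h x i = φ i x := rfl

theorem norm_analysis_le : ‖analysis φ h‖ ≤ 1 := LinearMap.mkContinuous_norm_le _ zero_le_one _

end Analysis

/-- The diagonal operator on `ℓ_2` with coefficients in `[0, 1]`. -/
def diag (d : ι → ℝ≥0) (hd : ∀ i, d i ≤ 1) : EllTwo 𝕜 ι →L[𝕜] EllTwo 𝕜 ι :=
  analysis (fun i => ((d i : ℝ) : 𝕜) • lp.evalCLM 𝕜 (fun _ : ι => 𝕜) 2 i) fun x => by
    rw [enorm_sq_eq_tsum]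
    refine ENNReal.tsum_le_tsum fun i => ?_
    gcongr
    rw [enorm_le_iff_norm_le]
    change ‖((d i : ℝ) : 𝕜) * x i‖ ≤ _
    rw [norm_mul, RCLike.norm_ofReal, NNReal.abs_eq]
    exact mul_le_of_le_one_left (norm_nonneg _) (hd i)

theorem diag_apply (d : ι → ℝ≥0) (hd : ∀ i, d i ≤ 1) (x : EllTwo 𝕜 ι) (i : ι) :
    diag d hd x i = ((d i : ℝ) : 𝕜) * x i := rfl

/-- The finite truncations converge in operator norm: the error is again diagonal, with entries that
are eventually below any `ε / 2`. -/
theorem isCompactOperator_diag {d : ι → ℝ≥0} (hd : ∀ i, d i ≤ 1) (h0 : Tendsto d cofinite (𝓝 0)) :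
    IsCompactOperator (diag (𝕜 := 𝕜) d hd) := by
  classical
  let R : ι → EllTwo 𝕜 ι →L[𝕜] EllTwo 𝕜 ι := fun i =>
    (lp.singleContinuousLinearMap 𝕜 (fun _ : ι => 𝕜) 2 i) ∘L
      (((d i : ℝ) : 𝕜) • lp.evalCLM 𝕜 (fun _ : ι => 𝕜) 2 i)
  have hR : ∀ s : Finset ι, IsCompactOperator (∑ i ∈ s, R i : EllTwo 𝕜 ι →L[𝕜] EllTwo 𝕜 ι) := fun s => by
    induction s using Finset.induction_on with
    | empty =>
      rw [Finset.sum_empty]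
      exact isCompactOperator_zero
    | insert i s hi ih =>
      rw [Finset.sum_insert hi]
      exact ((isCompactOperator_of_locallyCompactSpace_dom
        (((d i : ℝ) : 𝕜) • lp.evalCLM 𝕜 (fun _ : ι => 𝕜) 2 i)).clm_comp
          (lp.singleContinuousLinearMap 𝕜 (fun _ : ι => 𝕜) 2 i)).add ih
  refine isCompactOperator_of_tendsto (l := atTop) (F := fun s : Finset ι => ∑ i ∈ s, R i) ?_
    (Eventually.of_forall hR)
  rw [Metric.tendsto_atTop]
  intro ε hε
  have hfin : {i | ¬ d i < (ε / 2).toNNReal}.Finite :=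
    h0.eventually (Iio_mem_nhds (by simpa using hε))
  refine ⟨hfin.toFinset, fun s hs => ?_⟩
  rw [dist_eq_norm, ← norm_neg, neg_sub]
  refine (ContinuousLinearMap.opNorm_le_bound _ (half_pos hε).le fun x => ?_).trans_lt
    (half_lt_self hε)
  refine norm_le_mul_norm (half_pos hε).le fun i => ?_
  have hval : (diag (𝕜 := 𝕜) d hd - ∑ i ∈ s, R i) x i = if i ∈ s then 0 else ((d i : ℝ) : 𝕜) * x i := by
    have h1 : ((∑ j ∈ s, R j) x) i = ∑ j ∈ s, if i = j then ((d j : ℝ) : 𝕜) * x j else 0 := by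
      rw [sum_apply, lp.coeFn_sum, Finset.sum_apply]
      refine Finset.sum_congr rfl fun j _ => ?_
      change (lp.single 2 j (((d j : ℝ) : 𝕜) * x j) : EllTwo 𝕜 ι) i = _
      rw [lp.single_apply, Pi.single_apply]
    rw [sub_apply, lp.coeFn_sub, Pi.sub_apply, h1, Finset.sum_ite_eq, diag_apply]
    split_ifs <;> simp
  rw [hval]
  split_ifs with hi
  · rw [norm_zero]; positivity
  · rw [norm_mul, RCLike.norm_ofReal, NNReal.abs_eq]
    gcongr
    have : d i < (ε / 2).toNNReal := by
      by_contra hcon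
      exact hi (hs (hfin.mem_toFinset.2 hcon))
    rw [← Real.coe_toNNReal _ (half_pos hε).le]
    exact_mod_cast this.le

/-- A weakly `2`-summable sequence defines an operator on `ℓ_2`. -/
theorem exists_synthesis {Y : Type*} [NormedAddCommGroup Y] [NormedSpace 𝕜 Y] [CompleteSpace Y]
    (y : ι → Y) (hy : ∀ g : StrongDual 𝕜 Y, ‖g‖ ≤ 1 → ∑' i, ‖g (y i)‖ₑ ^ 2 ≤ 1) :
    ∃ B : EllTwo 𝕜 ι →L[𝕜] Y, ‖B‖ ≤ 1 ∧ ∀ c, HasSum (fun i => c i • y i) (B c) := by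
  have hbound : ∀ (c : ι → 𝕜) (s : Finset ι),
      ‖∑ i ∈ s, c i • y i‖ ≤ √(∑ i ∈ s, ‖c i‖ ^ 2) := fun c s => by
    obtain ⟨g, hg, hgx⟩ := exists_dual_vector'' 𝕜 (∑ i ∈ s, c i • y i)
    calc ‖∑ i ∈ s, c i • y i‖ = ‖∑ i ∈ s, c i * g (y i)‖ := by
          have := congrArg norm hgx
          rw [RCLike.norm_ofReal, abs_norm] at this
          simp [← this]
      _ ≤ ∑ i ∈ s, ‖c i‖ * ‖g (y i)‖ := (norm_sum_le _ _).trans_eq (by simp_rw [norm_mul])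
      _ ≤ √(∑ i ∈ s, ‖c i‖ ^ 2) * √(∑ i ∈ s, ‖g (y i)‖ ^ 2) :=
          Real.sum_mul_le_sqrt_mul_sqrt _ _ _
      _ ≤ √(∑ i ∈ s, ‖c i‖ ^ 2) * 1 := by
          gcongr
          exact Real.sqrt_le_one.2 (sum_norm_sq_le_one (hy g hg) s)
      _ = _ := mul_one _
  have hsq : ∀ c : EllTwo 𝕜 ι, HasSum (fun i => ‖c i‖ ^ 2) (‖c‖ ^ 2) := fun c => by
    simpa using lp.hasSum_norm (p := 2) (by norm_num) c
  have hsum : ∀ c : EllTwo 𝕜 ι, Summable fun i => c i • y i := fun c => by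
    rw [summable_iff_vanishing_norm]
    intro ε hε
    obtain ⟨s, hs⟩ := summable_iff_vanishing_norm.1 (hsq c).summable (ε ^ 2) (by positivity)
    refine ⟨s, fun t ht => (hbound c t).trans_lt ?_⟩
    rw [Real.sqrt_lt' hε]
    exact (le_abs_self _).trans_lt (hs t ht)
  let B₀ : EllTwo 𝕜 ι →ₗ[𝕜] Y :=
    { toFun := fun c => ∑' i, c i • y i
      map_add' := fun a b => by
        rw [← (hsum a).tsum_add (hsum b)]
        exact tsum_congr fun i => add_smul _ _ _
      map_smul' := fun r a => by
        rw [RingHom.id_apply, ← (hsum a).tsum_const_smul]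
        exact tsum_congr fun i => mul_smul _ _ _ }
  refine ⟨B₀.mkContinuous 1 fun c => ?_, LinearMap.mkContinuous_norm_le _ zero_le_one _,
    fun c => (hsum c).hasSum⟩
  refine le_of_tendsto (hsum c).hasSum.norm (Eventually.of_forall fun s => (hbound c s).trans ?_)
  rw [one_mul]
  exact Real.sqrt_le_iff.2 ⟨norm_nonneg _, sum_le_hasSum s (fun _ _ => by positivity) (hsq c)⟩

theorem tsum_enorm_sq_functional_le [DecidableEq ι] (ψ : StrongDual 𝕜 (EllTwo 𝕜 ι))
    (hψ : ‖ψ‖ ≤ 1) : ∑' i, ‖ψ (lp.single 2 i 1)‖ₑ ^ 2 ≤ 1 := by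
  obtain ⟨z, rfl⟩ := (InnerProductSpace.toDual 𝕜 (EllTwo 𝕜 ι)).surjective ψ
  rw [LinearIsometryEquiv.norm_map] at hψ
  have : ∀ i, ‖InnerProductSpace.toDual 𝕜 (EllTwo 𝕜 ι) z (lp.single 2 i 1)‖ₑ = ‖z i‖ₑ := fun i => by
    rw [InnerProductSpace.toDual_apply_apply, lp.inner_single_right]
    simp [← ofReal_norm]
  simp_rw [this]
  rw [← enorm_sq_eq_tsum]
  refine pow_le_one₀ zero_le ?_
  rw [← ofReal_norm]
  exact ENNReal.ofReal_le_one.2 hψ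

end EllTwo

/-! ### Singular value decomposition and diagonalization without loss of constant. -/

section SingularValues

variable {𝕜 : Type u} [RCLike 𝕜]

theorem Orthonormal.tsum_enorm_inner_sq_le {ι E : Type*} [NormedAddCommGroup E]
    [InnerProductSpace 𝕜 E] {g : ι → E} (hg : Orthonormal 𝕜 g) (x : E) :
    ∑' i, ‖⟪g i, x⟫_𝕜‖ₑ ^ 2 ≤ ‖x‖ₑ ^ 2 := by
  rw [ENNReal.tsum_eq_iSup_sum]
  refine iSup_le fun s => ?_
  simp_rw [← ofReal_norm, ← ENNReal.ofReal_pow (norm_nonneg _)]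
  rw [← ENNReal.ofReal_sum_of_nonneg fun _ _ => by positivity]
  exact ENNReal.ofReal_le_ofReal (hg.sum_inner_products_le x)

/-- Bessel's inequality for a normalized orthogonal family that may contain zeros. -/
theorem tsum_enorm_inner_normalize_sq_le {ι E : Type*} [NormedAddCommGroup E]
    [InnerProductSpace 𝕜 E] {v : ι → E} (hv : Pairwise fun i j => ⟪v i, v j⟫_𝕜 = 0) (x : E) :
    ∑' i, ‖⟪((‖v i‖⁻¹ : ℝ) : 𝕜) • v i, x⟫_𝕜‖ₑ ^ 2 ≤ ‖x‖ₑ ^ 2 := by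
  have hg : Orthonormal 𝕜 fun i : {i // v i ≠ 0} => ((‖v i‖⁻¹ : ℝ) : 𝕜) • v i := by
    refine ⟨fun i => ?_, fun i j hij => ?_⟩
    · rw [norm_smul, RCLike.norm_ofReal, abs_inv, abs_norm]
      exact inv_mul_cancel₀ (norm_ne_zero_iff.2 i.2)
    · simp only [inner_smul_left, inner_smul_right]
      rw [hv fun h => hij (Subtype.ext h)]
      simp
  refine le_trans (le_of_eq ?_) (Orthonormal.tsum_enorm_inner_sq_le hg x)
  refine (tsum_subtype_eq_of_support_subset (s := {i | v i ≠ 0}) fun i hi h => hi ?_).symm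
  simp [h]

theorem inner_eq_zero_of_hilbertBasis {ι E : Type*} [NormedAddCommGroup E] [InnerProductSpace 𝕜 E]
    {S : Submodule 𝕜 E} (b : HilbertBasis ι 𝕜 S) {x : E} (h : ∀ i, ⟪x, (b i : E)⟫_𝕜 = 0) (y : S) :
    ⟪x, (y : E)⟫_𝕜 = 0 := by
  have h1 := (b.hasSum_repr y).mapL ((innerSL 𝕜 x) ∘L S.subtypeL)
  refine HasSum.unique h1 ?_
  convert! hasSum_zero with i
  change ⟪x, ((b.repr y i • b i : S) : E)⟫_𝕜 = 0
  rw [Submodule.coe_smul, inner_smul_right, h, mul_zero]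

/-- The singular value decomposition of a compact operator: there is a Hilbert basis with orthogonal
image. -/
theorem exists_hilbertBasis_orthogonal_image {H : Type w} {K : Type*} [NormedAddCommGroup H]
    [InnerProductSpace 𝕜 H] [CompleteSpace H] [NormedAddCommGroup K] [InnerProductSpace 𝕜 K]
    [CompleteSpace K] (V : H →L[𝕜] K) (hV : IsCompactOperator V) :
    ∃ (κ : Type (max u w)) (f : HilbertBasis κ 𝕜 H),
      Pairwise fun i j => ⟪V (f i), V (f j)⟫_𝕜 = 0 := by
  set P : H →L[𝕜] H := ContinuousLinearMap.adjoint V ∘L V with hP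
  have hcomp : IsCompactOperator P := hV.clm_comp (ContinuousLinearMap.adjoint V)
  have hsymm : P.IsSymmetric := fun x y => by
    change ⟪ContinuousLinearMap.adjoint V (V x), y⟫_𝕜 = ⟪x, ContinuousLinearMap.adjoint V (V y)⟫_𝕜
    rw [ContinuousLinearMap.adjoint_inner_left, ContinuousLinearMap.adjoint_inner_right]
  have hbot := ContinuousLinearMap.orthogonalComplement_iSup_eigenspaces_eq_bot hcomp hsymm
  have hclosed : ∀ μ : 𝕜,
      IsClosed (Module.End.eigenspace (P : Module.End 𝕜 H) μ : Set H) := fun μ => by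
    have : (Module.End.eigenspace (P : Module.End 𝕜 H) μ : Set H) = {x | P x = μ • x} := by
      ext x
      exact Module.End.mem_eigenspace_iff
    rw [this]
    exact isClosed_eq P.continuous (continuous_const_smul μ)
  have hcs : ∀ μ : 𝕜, CompleteSpace (Module.End.eigenspace (P : Module.End 𝕜 H) μ) := fun μ =>
    (hclosed μ).completeSpace_coe
  choose w b hb using fun μ : 𝕜 =>
    exists_hilbertBasis 𝕜 (Module.End.eigenspace (P : Module.End 𝕜 H) μ)
  let f : (Σ μ : 𝕜, w μ) → H := fun j => b j.1 j.2
  have hf : Orthonormal 𝕜 f :=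
    hsymm.orthogonalFamily_eigenspaces.orthonormal_sigma_orthonormal fun μ => (b μ).orthonormal
  have hspan : (Submodule.span 𝕜 (Set.range f))ᗮ = ⊥ := by
    rw [eq_bot_iff, ← hbot]
    rw [← Submodule.iInf_orthogonal]
    refine le_iInf fun μ x hx => ?_
    rw [Submodule.mem_orthogonal]
    intro y hy
    exact inner_eq_zero_symm.1 (inner_eq_zero_of_hilbertBasis (b μ) (fun i =>
      inner_eq_zero_symm.1 ((Submodule.mem_orthogonal _ _).1 hx _
        (Submodule.subset_span ⟨⟨μ, i⟩, rfl⟩))) ⟨y, hy⟩)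
  refine ⟨_, HilbertBasis.mkOfOrthogonalEqBot hf hspan, fun i j hij => ?_⟩
  rw [HilbertBasis.coe_mkOfOrthogonalEqBot]
  change ⟪V (f i), V (f j)⟫_𝕜 = 0
  rw [← ContinuousLinearMap.adjoint_inner_right]
  have : P (f j) = j.1 • f j := Module.End.mem_eigenspace_iff.1 (b j.1 j.2).2
  change ⟪f i, P (f j)⟫_𝕜 = 0
  rw [this, inner_smul_right, hf.2 hij, mul_zero]

/-- The singular numbers of a compact operator `V` on `ℓ_2(ι)` are controlled by the norms of the
images of the unit vectors, for exponents at most `2`. -/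
theorem exists_diag_factorization {ι : Type w} [DecidableEq ι] {K : Type*} [NormedAddCommGroup K]
    [InnerProductSpace 𝕜 K] [CompleteSpace K] (V : EllTwo 𝕜 ι →L[𝕜] K) (hV : IsCompactOperator V)
    {t : ℝ} (ht : 1 / 2 ≤ t) (u : ι → ℝ≥0∞) (hu : ∑' i, u i ≤ 1)
    (h : ∀ i, ‖V (lp.single 2 i 1)‖ₑ ≤ u i ^ t) :
    ∃ (κ : Type (max u w)) (d : κ → ℝ≥0) (hd : ∀ j, d j ≤ 1) (z : κ → ℝ≥0∞)
      (A : EllTwo 𝕜 ι →L[𝕜] EllTwo 𝕜 κ) (B : EllTwo 𝕜 κ →L[𝕜] K), ‖A‖ ≤ 1 ∧ ‖B‖ ≤ 1 ∧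
      ∑' j, z j ≤ 1 ∧ (∀ j, (d j : ℝ≥0∞) ≤ z j ^ t) ∧ V = B ∘L diag d hd ∘L A := by
  classical
  have ht0 : 0 < t := by linarith
  obtain ⟨κ, f, hf⟩ := exists_hilbertBasis_orthogonal_image V hV
  have hbessel := fun k => tsum_enorm_inner_normalize_sq_le hf k
  have hVsum : ∀ x, HasSum (fun j => f.repr x j • V (f j)) (V x) := fun x => by
    simpa using (f.hasSum_repr x).mapL V
  have hinner : ∀ x j, ⟪((‖V (f j)‖⁻¹ : ℝ) : 𝕜) • V (f j), V x⟫_𝕜 =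
      ((‖V (f j)‖ : ℝ) : 𝕜) * f.repr x j := fun x j => by
    have h1 := (hVsum x).mapL (innerSL 𝕜 (V (f j)))
    have h2 : ⟪V (f j), V x⟫_𝕜 = f.repr x j * ((‖V (f j)‖ : ℝ) : 𝕜) ^ 2 := by
      have h3 := hasSum_single (f := fun k => innerSL 𝕜 (V (f j)) (f.repr x k • V (f k))) j
        fun k hk => by
          rw [innerSL_apply_apply, inner_smul_right, hf (Ne.symm hk), mul_zero]
      rw [innerSL_apply_apply, inner_smul_right, inner_self_eq_norm_sq_to_K] at h3
      exact h1.unique h3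
    rw [inner_smul_left, h2, RCLike.conj_ofReal]
    by_cases h0 : ‖V (f j)‖ = 0
    · simp [h0]
    · have h0' : ((‖V (f j)‖ : ℝ) : 𝕜) ≠ 0 := by exact_mod_cast h0
      push_cast
      field_simp
  have hcoef : ∀ x, ∑' j, ‖f.repr x j‖ₑ ^ 2 * ‖V (f j)‖ₑ ^ 2 ≤ ‖V x‖ₑ ^ 2 := fun x => by
    refine le_trans (le_of_eq ?_) (hbessel (V x))
    refine tsum_congr fun j => ?_
    rw [hinner, enorm_mul, mul_pow, mul_comm]
    simp [← ofReal_norm]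
  have hθ : 1 / (2 * t) ≤ 1 := (div_le_one (by positivity)).2 (by linarith)
  have hrepr : ∀ i j, ‖f.repr (lp.single 2 i 1) j‖ₑ = ‖f j i‖ₑ := fun i j => by
    rw [f.repr_apply_apply, lp.inner_single_right]
    simp [← ofReal_norm]
  -- Insert `1 = ∑_i |f_j(i)|²` and exchange the sums. For fixed `i` the weights `|f_j(i)|²` have
  -- mass at most one, so Jensen with exponent `1/(2t) ≤ 1` and `hcoef` bound the inner sum by `‖V
  -- e_i‖^(1/t) ≤ u i`.
  have hz : ∑' j, ‖V (f j)‖ₑ ^ (1 / t) ≤ 1 := by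
    have e1 : ∀ j, ‖V (f j)‖ₑ ^ (1 / t) =
        ∑' i, ‖f.repr (lp.single 2 i 1) j‖ₑ ^ 2 * (‖V (f j)‖ₑ ^ 2) ^ (1 / (2 * t)) := fun j => by
      rw [ENNReal.tsum_mul_right]
      simp_rw [hrepr]
      have hfj : ‖f j‖ₑ = 1 := by rw [← ofReal_norm, f.orthonormal.1 j, ENNReal.ofReal_one]
      rw [← enorm_sq_eq_tsum, hfj, ← ENNReal.rpow_natCast (‖V (f j)‖ₑ),
        ← ENNReal.rpow_mul]
      have : ((2 : ℕ) : ℝ) * (1 / (2 * t)) = 1 / t := by push_cast; field_simp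
      rw [this]
      simp
    simp_rw [e1]
    rw [ENNReal.tsum_comm]
    refine le_trans (ENNReal.tsum_le_tsum fun i => ?_) hu
    have hw : ∑' j, ‖f.repr (lp.single 2 i 1) j‖ₑ ^ 2 ≤ 1 := by
      rw [← enorm_sq_eq_tsum, ← ofReal_norm, LinearIsometryEquiv.norm_map,
        lp.norm_single (by norm_num)]
      simp
    refine (tsum_mul_rpow_le _ _ hw (by positivity) hθ).trans ?_
    calc _ ≤ ((u i ^ t) ^ 2) ^ (1 / (2 * t)) := by
          refine ENNReal.rpow_le_rpow ((hcoef _).trans ?_) (by positivity)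
          gcongr
          exact h i
      _ = u i := by
        rw [← ENNReal.rpow_natCast, ← ENNReal.rpow_mul, ← ENNReal.rpow_mul]
        have : t * (((2 : ℕ) : ℝ) * (1 / (2 * t))) = 1 := by push_cast; field_simp
        rw [this, ENNReal.rpow_one]
  have hpow : ∀ j, ‖V (f j)‖ₑ = (‖V (f j)‖ₑ ^ (1 / t)) ^ t := fun j => by
    rw [← ENNReal.rpow_mul, one_div, inv_mul_cancel₀ ht0.ne', ENNReal.rpow_one]
  have hd : ∀ j, ‖V (f j)‖₊ ≤ 1 := fun j => by
    rw [← ENNReal.coe_le_coe, ← enorm_eq_nnnorm, hpow]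
    exact ENNReal.rpow_le_one (le_one_of_tsum_le_one hz j) ht0.le
  obtain ⟨B, hB, hBsum⟩ := exists_synthesis (fun j => ((‖V (f j)‖⁻¹ : ℝ) : 𝕜) • V (f j))
    fun g hg => by
      obtain ⟨k, rfl⟩ := (InnerProductSpace.toDual 𝕜 K).surjective g
      rw [LinearIsometryEquiv.norm_map] at hg
      have hk : ‖k‖ₑ ^ 2 ≤ 1 := by
        refine pow_le_one₀ zero_le ?_
        rw [← ofReal_norm]
        exact ENNReal.ofReal_le_one.2 hg
      refine le_trans (le_of_eq (tsum_congr fun j => ?_)) ((hbessel k).trans hk)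
      rw [InnerProductSpace.toDual_apply_apply, ← ofReal_norm, norm_inner_symm, ofReal_norm]
  refine ⟨κ, fun j => ‖V (f j)‖₊, hd, fun j => ‖V (f j)‖ₑ ^ (1 / t),
    f.repr.toLinearIsometry.toContinuousLinearMap, B,
    f.repr.toLinearIsometry.norm_toContinuousLinearMap_le, hB, hz, fun j => (hpow j).le, ?_⟩
  ext1 x
  refine (hVsum x).unique ?_
  convert! hBsum (diag (fun j => ‖V (f j)‖₊) hd (f.repr x)) using 2 with j
  rw [diag_apply, smul_smul, coe_nnnorm]
  by_cases h0 : V (f j) = 0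
  · simp [h0]
  · have h0' : ((‖V (f j)‖ : ℝ) : 𝕜) ≠ 0 := by exact_mod_cast norm_ne_zero_iff.2 h0
    congr 1
    push_cast
    field_simp

end SingularValues

/-! ### Diagonal factorizations and their composition with nuclear operators. -/

section DiagFactor

variable {𝕜 : Type u} [RCLike 𝕜]

/-- `S = C • B D A` with contractions `A`, `B` and a compact diagonal operator `D` on an `ℓ_2`-space
whose diagonal is dominated by the `t`-th power of a sequence in the unit ball of `ℓ_1`. -/
def DiagFactor {X : Type v} {Y : Type*} [NormedAddCommGroup X] [NormedSpace 𝕜 X]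
    [NormedAddCommGroup Y] [NormedSpace 𝕜 Y] (t : ℝ) (C : ℝ≥0) (S : X →L[𝕜] Y) : Prop :=
  ∃ (ι : Type (max u v)) (d : ι → ℝ≥0) (hd : ∀ i, d i ≤ 1) (z : ι → ℝ≥0∞)
    (A : X →L[𝕜] EllTwo 𝕜 ι) (B : EllTwo 𝕜 ι →L[𝕜] Y), ‖A‖ ≤ 1 ∧ ‖B‖ ≤ 1 ∧
    Tendsto d cofinite (𝓝 0) ∧ ∑' i, z i ≤ 1 ∧ (∀ i, (d i : ℝ≥0∞) ≤ z i ^ t) ∧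
    S = ((C : ℝ) : 𝕜) • (B ∘L diag d hd ∘L A)

variable {X : Type v} [NormedAddCommGroup X] [NormedSpace 𝕜 X]
  {Y : Type*} [NormedAddCommGroup Y] [NormedSpace 𝕜 Y]
  {Z : Type*} [NormedAddCommGroup Z] [NormedSpace 𝕜 Z]

theorem norm_comp_le_one {E F G : Type*} [NormedAddCommGroup E] [NormedSpace 𝕜 E]
    [NormedAddCommGroup F] [NormedSpace 𝕜 F] [NormedAddCommGroup G] [NormedSpace 𝕜 G]
    {B : F →L[𝕜] G} {A : E →L[𝕜] F} (hB : ‖B‖ ≤ 1) (hA : ‖A‖ ≤ 1) : ‖B ∘L A‖ ≤ 1 :=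
  (B.opNorm_comp_le A).trans (mul_le_one₀ hB (norm_nonneg _) hA)

theorem DiagFactor.comp_contraction {t : ℝ} {C : ℝ≥0} {S : X →L[𝕜] Y} (h : DiagFactor t C S)
    {R : Y →L[𝕜] Z} (hR : ‖R‖ ≤ 1) : DiagFactor t C (R ∘L S) := by
  obtain ⟨ι, d, hd, z, A, B, hA, hB, h0, hz, hdz, rfl⟩ := h
  refine ⟨ι, d, hd, z, A, R ∘L B, hA, norm_comp_le_one hR hB, h0, hz, hdz, ?_⟩
  ext x
  simp

theorem DiagFactor.smul {t : ℝ} {C : ℝ≥0} {S : X →L[𝕜] Y} (h : DiagFactor t C S) (c : ℝ≥0) :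
    DiagFactor t (c * C) (((c : ℝ) : 𝕜) • S) := by
  obtain ⟨ι, d, hd, z, A, B, hA, hB, h0, hz, hdz, rfl⟩ := h
  refine ⟨ι, d, hd, z, A, B, hA, hB, h0, hz, hdz, ?_⟩
  rw [smul_smul]
  push_cast
  rfl

theorem tendsto_zero_of_le_rpow {ι : Type*} {d : ι → ℝ≥0} {z : ι → ℝ≥0∞} (hz : ∑' i, z i ≤ 1)
    {t : ℝ} (ht : 0 < t) (h : ∀ i, (d i : ℝ≥0∞) ≤ z i ^ t) : Tendsto d cofinite (𝓝 0) := by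
  have h1 := ENNReal.tendsto_cofinite_zero_of_tsum_ne_top (hz.trans_lt ENNReal.one_lt_top).ne
  have h2 := ((ENNReal.continuous_rpow_const (y := t)).tendsto 0).comp h1
  rw [ENNReal.zero_rpow_of_pos ht] at h2
  rw [← ENNReal.tendsto_coe, ENNReal.coe_zero]
  exact tendsto_of_tendsto_of_tendsto_of_le_of_le tendsto_const_nhds h2 (fun _ => zero_le) h

/-- The diagonal scales unit vectors, so `‖R B D e_i‖ ≤ z_i^t w_i^τ`; this is a single power
`q_i^(t+τ)`, and the singular value decomposition of `R B D` supplies the new diagonal. The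
hypothesis on `R` ranges over all contractions `B` because the one inside `S` is existentially
hidden. -/
theorem DiagFactor.comp_left {K : Type*} [NormedAddCommGroup K] [InnerProductSpace 𝕜 K]
    [CompleteSpace K] {t τ : ℝ} {C : ℝ≥0} {S : X →L[𝕜] Y} (h : DiagFactor t C S) (R : Y →L[𝕜] K)
    (ht : 0 ≤ t) (hτ : 0 ≤ τ) (htτ : 1 / 2 ≤ t + τ)
    (hR : ∀ {ι : Type (max u v)} [DecidableEq ι] (B : EllTwo 𝕜 ι →L[𝕜] Y), ‖B‖ ≤ 1 →
      ∃ w : ι → ℝ≥0∞, ∑' i, w i ≤ 1 ∧ ∀ i, ‖R (B (lp.single 2 i 1))‖ₑ ≤ w i ^ τ) :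
    DiagFactor (t + τ) C (R ∘L S) := by
  classical
  obtain ⟨ι, d, hd, z, A, B, hA, hB, h0, hz, hdz, rfl⟩ := h
  obtain ⟨w, hw, hwR⟩ := hR B hB
  obtain ⟨q, hq, hqz⟩ := exists_rpow_mul_rpow_le hz hw ht hτ (by linarith)
  have hV : ∀ i, ‖(R ∘L B ∘L diag d hd) (lp.single 2 i 1)‖ₑ ≤ q i ^ (t + τ) := fun i => by
    have : diag d hd (lp.single 2 i 1 : EllTwo 𝕜 ι) = ((d i : ℝ) : 𝕜) • lp.single 2 i 1 := by
      ext j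
      rw [diag_apply, lp.coeFn_smul, Pi.smul_apply, lp.single_apply, Pi.single_apply, smul_eq_mul]
      split_ifs with hij
      · rw [hij]
      · simp
    change ‖R (B (diag d hd (lp.single 2 i 1)))‖ₑ ≤ _
    rw [this, map_smul, map_smul, enorm_smul]
    refine le_trans ?_ (hqz i)
    refine mul_le_mul' (le_trans (le_of_eq ?_) (hdz i)) (hwR i)
    simp [← ofReal_norm]
  obtain ⟨κ, d', hd', z', A', B', hA', hB', hz', hdz', hfac⟩ := exists_diag_factorization
    (R ∘L B ∘L diag d hd) ((isCompactOperator_diag hd h0).clm_comp (R ∘L B)) htτ q hq hV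
  refine ⟨κ, d', hd', z', A' ∘L A, B', norm_comp_le_one hA' hA, hB',
    tendsto_zero_of_le_rpow hz' (by linarith) hdz', hz', hdz', ?_⟩
  ext x
  have := congrArg (fun F : EllTwo 𝕜 ι →L[𝕜] K => F (A x)) hfac
  simp only [ContinuousLinearMap.comp_apply] at this
  simp [this]

/-- After exchanging the sums, each functional contributes at most `a n`, since its values on the
unit vectors are square summable with sum at most one. This yields the sequence `w` needed in
`DiagFactor.comp_left`. -/
theorem tsum_tsum_mul_enorm_sq_le {ι κ : Type*} [DecidableEq ι] {a : κ → ℝ≥0∞}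
    (ha : ∑' n, a n ≤ 1) {ψ : κ → StrongDual 𝕜 (EllTwo 𝕜 ι)} (hψ : ∀ n, ‖ψ n‖ ≤ 1) :
    ∑' i, ∑' n, a n * ‖ψ n (lp.single 2 i 1)‖ₑ ^ 2 ≤ 1 := by
  rw [ENNReal.tsum_comm]
  simp_rw [ENNReal.tsum_mul_left]
  refine le_trans (ENNReal.tsum_le_tsum fun n => ?_) ha
  exact (mul_le_mul_right (tsum_enorm_sq_functional_le (ψ n) (hψ n)) _).trans_eq (mul_one _)

/-- Composition with a Hilbert–Schmidt operator given by bounded functionals. -/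
theorem DiagFactor.comp_hilbertSchmidt {κ : Type*} {t : ℝ} {C : ℝ≥0} {S : X →L[𝕜] Y}
    (h : DiagFactor t C S) (ht : 0 ≤ t) (R : Y →L[𝕜] EllTwo 𝕜 κ) (a : κ → ℝ≥0∞)
    (ha : ∑' n, a n ≤ 1) (φ : κ → StrongDual 𝕜 Y) (hφ : ∀ n, ‖φ n‖ ≤ 1)
    (hR : ∀ y n, ‖R y n‖ₑ ^ 2 ≤ a n * ‖φ n y‖ₑ ^ 2) : DiagFactor (t + 1 / 2) C (R ∘L S) := by
  refine h.comp_left R ht (by norm_num) (by linarith) fun {ι} _ B hB => ?_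
  refine ⟨fun i => ∑' n, a n * ‖φ n (B (lp.single 2 i 1))‖ₑ ^ 2,
    tsum_tsum_mul_enorm_sq_le ha (ψ := fun n => φ n ∘L B)
      fun n => norm_comp_le_one (hφ n) hB, fun i => ?_⟩
  rw [one_div, ENNReal.le_rpow_inv_iff (by norm_num), ENNReal.rpow_two, enorm_sq_eq_tsum]
  exact ENNReal.tsum_le_tsum fun n => hR _ n

/-- Composition with a diagonal operator. -/
theorem DiagFactor.comp_diag {κ : Type*} {t τ : ℝ} {C : ℝ≥0} {S : X →L[𝕜] EllTwo 𝕜 κ}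
    (h : DiagFactor t C S) (ht : 1 / 2 ≤ t) (hτ : 0 ≤ τ) (hτ' : τ ≤ 1 / 2) (c : κ → ℝ≥0)
    (hc : ∀ n, c n ≤ 1) (a : κ → ℝ≥0∞) (ha : ∑' n, a n ≤ 1)
    (hca : ∀ n, (c n : ℝ≥0∞) ≤ a n ^ τ) : DiagFactor (t + τ) C (diag c hc ∘L S) := by
  refine h.comp_left _ (by linarith) hτ (by linarith) fun {ι} _ B hB => ?_
  refine ⟨fun i => ∑' n, a n * ‖B (lp.single 2 i 1) n‖ₑ ^ 2,
    tsum_tsum_mul_enorm_sq_le ha (ψ := fun n => lp.evalCLM 𝕜 (fun _ : κ => 𝕜) 2 n ∘L B)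
      fun n => norm_comp_le_one ?_ hB, fun i => ?_⟩
  · exact ContinuousLinearMap.opNorm_le_bound _ zero_le_one fun x => by
      rw [one_mul]
      exact lp.norm_apply_le_norm two_ne_zero x n
  · set y := B (lp.single 2 i 1) with hy
    have hy1 : ∑' n, ‖y n‖ₑ ^ 2 ≤ 1 := by
      rw [← enorm_sq_eq_tsum]
      refine pow_le_one₀ zero_le ?_
      rw [← ofReal_norm]
      refine ENNReal.ofReal_le_one.2 ((B.le_opNorm _).trans ?_)
      rw [lp.norm_single (by norm_num)]
      simpa using hB
    rw [← ENNReal.pow_le_pow_left_iff two_ne_zero, enorm_sq_eq_tsum]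
    -- Jensen with weights `|y_n|²`, of mass at most one; concavity requires `2 * τ ≤ 1`.
    calc ∑' n, ‖diag c hc y n‖ₑ ^ 2 ≤ ∑' n, ‖y n‖ₑ ^ 2 * a n ^ (2 * τ) := by
          refine ENNReal.tsum_le_tsum fun n => ?_
          rw [diag_apply, enorm_mul, mul_pow, mul_comm, mul_comm 2 τ, ENNReal.rpow_mul,
            ENNReal.rpow_two]
          gcongr
          refine le_trans (le_of_eq ?_) (hca n)
          simp [← ofReal_norm]
      _ ≤ (∑' n, ‖y n‖ₑ ^ 2 * a n) ^ (2 * τ) :=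
          tsum_mul_rpow_le _ _ hy1 (by positivity) (by linarith)
      _ = _ := by
          rw [mul_comm 2 τ, ENNReal.rpow_mul, ENNReal.rpow_two]
          simp_rw [mul_comm]
          rfl

/-- A normalized nuclear representation, up to the factor `C`: the coefficients are `τ`-th powers
of a positive sequence of sum less than one. -/
def NuclearRep (τ : ℝ) (C : ℝ≥0) (T : Y →L[𝕜] Z) : Prop :=
  ∃ (a : ℕ → ℝ≥0) (φ : ℕ → StrongDual 𝕜 Y) (y : ℕ → Z) (S : Y →L[𝕜] Z),
    ∑' n, (a n : ℝ≥0∞) < 1 ∧ (∀ n, ‖φ n‖ ≤ 1) ∧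
    (∀ g : StrongDual 𝕜 Z, ‖g‖ ≤ 1 → ∑' n, ‖g (y n)‖ₑ ^ 2 ≤ 1) ∧
    (∀ x, HasSum (fun n => ((((a n ^ τ : ℝ≥0) : ℝ) : 𝕜) * φ n x) • y n) (S x)) ∧
    T = ((C : ℝ) : 𝕜) • S

theorem tsum_enorm_weighted_le {κ : Type*} {b : κ → ℝ≥0} (hb : ∑' n, (b n : ℝ≥0∞) ^ 2 ≤ 1)
    {φ : κ → StrongDual 𝕜 Y} (hφ : ∀ n, ‖φ n‖ ≤ 1) (x : Y) :
    ∑' n, ‖(((b n : ℝ) : 𝕜) • φ n) x‖ₑ ^ 2 ≤ ‖x‖ₑ ^ 2 := by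
  calc _ ≤ ∑' n, (b n : ℝ≥0∞) ^ 2 * ‖x‖ₑ ^ 2 := ENNReal.tsum_le_tsum fun n => by
        rw [smul_apply, enorm_smul, mul_pow]
        have h1 : ‖((b n : ℝ) : 𝕜)‖ₑ = b n := by simp [← ofReal_norm]
        have h2 : ‖φ n x‖ₑ ≤ ‖x‖ₑ := by
          rw [enorm_le_iff_norm_le]
          simpa using (φ n).le_of_opNorm_le (hφ n) x
        rw [h1]
        gcongr
    _ ≤ ‖x‖ₑ ^ 2 := by
        rw [ENNReal.tsum_mul_right]
        exact mul_le_of_le_one_left zero_le hb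

/-- Entering `ℓ_2` from a Banach space costs the exponent `1/2`. The strict bound on the sum of the
`a n` leaves room for weights `w n → ∞`, which force the diagonal to zero even when `τ = 1/2`. -/
theorem NuclearRep.diagFactor [CompleteSpace Y] {τ : ℝ} {C : ℝ≥0} {T : X →L[𝕜] Y}
    (h : NuclearRep τ C T) (hτ : 1 / 2 ≤ τ) : DiagFactor (τ - 1 / 2) C T := by
  obtain ⟨a, φ, y, S, ha, hφ, hy, hS, rfl⟩ := h
  obtain ⟨w, hw1, hw, haw⟩ := exists_weights_tendsto_atTop ha
  have hw0 : ∀ n, w n ≠ 0 := fun n => (zero_lt_one.trans_le (hw1 n)).ne'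
  have ha1 : ∀ n, a n ≤ 1 := fun n => by exact_mod_cast le_one_of_tsum_le_one ha.le n
  -- The coefficient `a^τ` is split as `d * b`: `b` is square summable and goes into the analysis
  -- map, `d` is the diagonal.
  set b : ℕ → ℝ≥0 := fun n => (a n * w n) ^ (1 / 2 : ℝ) with hb
  set d : ℕ → ℝ≥0 := fun n => a n ^ (τ - 1 / 2) * (w n ^ (1 / 2 : ℝ))⁻¹ with hd
  have hwinv : ∀ n, (w n ^ (1 / 2 : ℝ))⁻¹ ≤ 1 := fun n =>
    inv_le_one_of_one_le₀ (NNReal.one_le_rpow (hw1 n) (by norm_num))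
  have hda : ∀ n, d n ≤ a n ^ (τ - 1 / 2) := fun n => mul_le_of_le_one_right zero_le (hwinv n)
  have hapow : ∀ n, a n ^ (τ - 1 / 2) ≤ 1 := fun n => NNReal.rpow_le_one (ha1 n) (by linarith)
  have hd1 : ∀ n, d n ≤ 1 := fun n => (hda n).trans (hapow n)
  have hd0 : Tendsto d atTop (𝓝 0) := by
    have h1 : Tendsto (fun n => (w n ^ (1 / 2 : ℝ))⁻¹) atTop (𝓝 0) :=
      tendsto_inv_atTop_zero.comp
        ((NNReal.tendsto_rpow_atTop (by norm_num)).comp hw)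
    exact tendsto_of_tendsto_of_tendsto_of_le_of_le tendsto_const_nhds h1 (fun _ => zero_le)
      fun n => mul_le_of_le_one_left zero_le (hapow n)
  have hdb : ∀ n, d n * b n = a n ^ τ := fun n => by
    simp only [hb, hd]
    have hw2 : w n ^ (1 / 2 : ℝ) ≠ 0 := by simp [hw0]
    rw [NNReal.mul_rpow, mul_comm (a n ^ (1 / 2 : ℝ)), mul_assoc, inv_mul_cancel_left₀ hw2,
      ← NNReal.rpow_add_of_nonneg _ (by linarith) (by norm_num)]
    congr 1
    ring
  have hb2 : ∑' n, (b n : ℝ≥0∞) ^ 2 ≤ 1 := by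
    refine le_trans (le_of_eq (tsum_congr fun n => ?_)) haw
    rw [← ENNReal.coe_pow, ← ENNReal.coe_mul]
    congr 1
    simp only [hb]
    rw [← NNReal.rpow_natCast, ← NNReal.rpow_mul]
    norm_num
  have hbU : ∑' n : ULift.{max u v} ℕ, (b n.down : ℝ≥0∞) ^ 2 ≤ 1 :=
    (Equiv.ulift.tsum_eq fun n => (b n : ℝ≥0∞) ^ 2).trans_le hb2
  obtain ⟨B, hB, hBsum⟩ := exists_synthesis (fun n : ULift.{max u v} ℕ => y n.down) fun g hg =>
    (Equiv.ulift.tsum_eq fun n => ‖g (y n)‖ₑ ^ 2).trans_le (hy g hg)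
  refine ⟨ULift.{max u v} ℕ, fun n => d n.down, fun n => hd1 _, fun n => a n.down,
    analysis (fun n => ((b n.down : ℝ) : 𝕜) • φ n.down)
      (tsum_enorm_weighted_le hbU fun n => hφ n.down), B, norm_analysis_le _ _, hB, ?_, ?_,
    fun n => ?_, ?_⟩
  · rw [← Nat.cofinite_eq_atTop] at hd0
    exact hd0.comp ULift.down_injective.tendsto_cofinite
  · exact (Equiv.ulift.tsum_eq fun n => (a n : ℝ≥0∞)).trans_le ha.le
  · rw [← ENNReal.coe_rpow_of_nonneg _ (by linarith)]
    exact_mod_cast hda n.down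
  · congr 1
    ext1 x
    refine ((Equiv.ulift.{max u v}.hasSum_iff).2 (hS x)).unique ?_
    convert! hBsum _ using 2 with n
    change ((((a n.down ^ τ : ℝ≥0) : ℝ) : 𝕜) * φ n.down x) • y n.down =
      (((d n.down : ℝ) : 𝕜) * (((b n.down : ℝ) : 𝕜) * φ n.down x)) • y n.down
    rw [← mul_assoc, ← hdb]
    push_cast
    rfl

/-- Here the whole exponent `τ` is gained: `1/2` from the Hilbert–Schmidt analysis map and `τ - 1/2`
from the diagonal. -/
theorem NuclearRep.comp_diagFactor [CompleteSpace Z] {t τ : ℝ} {C c : ℝ≥0} {S : X →L[𝕜] Y}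
    {T : Y →L[𝕜] Z} (hT : NuclearRep τ c T) (hS : DiagFactor t C S) (ht : 0 ≤ t)
    (hτ : 1 / 2 ≤ τ) : DiagFactor (t + τ) (c * C) (T ∘L S) := by
  obtain ⟨a, φ, y, R, ha, hφ, hy, hR, rfl⟩ := hT
  have ha1 : ∀ n, a n ≤ 1 := fun n => by exact_mod_cast le_one_of_tsum_le_one ha.le n
  -- The exponent `τ - 1/2` may exceed `1/2`, so the diagonal is written as the `N`-th power of one
  -- with exponent `σ ≤ 1/2`; `2 * τ ≥ 1` also makes `N` positive.
  obtain ⟨N, hN⟩ := exists_nat_ge (2 * τ)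
  have hN0 : (0 : ℝ) < N := by linarith
  set σ : ℝ := (τ - 1 / 2) / N with hσ
  have hσ0 : 0 ≤ σ := div_nonneg (by linarith) hN0.le
  have hσ1 : σ ≤ 1 / 2 := by
    rw [hσ, div_le_iff₀ hN0]
    linarith
  have hb2 : ∀ n, ((a n ^ (1 / 2 : ℝ) : ℝ≥0) : ℝ≥0∞) ^ 2 = a n := fun n => by
    rw [← ENNReal.coe_pow, ← NNReal.rpow_natCast, ← NNReal.rpow_mul]
    norm_num
  set P : Y →L[𝕜] EllTwo 𝕜 ℕ := analysis (fun n => (((a n ^ (1 / 2 : ℝ) : ℝ≥0) : ℝ) : 𝕜) • φ n)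
    (tsum_enorm_weighted_le (by simp_rw [hb2]; exact ha.le) hφ) with hP
  have hc : ∀ n, a n ^ σ ≤ 1 := fun n => NNReal.rpow_le_one (ha1 n) hσ0
  have hiter : ∀ k : ℕ, DiagFactor (t + 1 / 2 + k * σ) C
      ((diag (𝕜 := 𝕜) (fun n => a n ^ σ) hc ^ k) ∘L (P ∘L S)) := fun k => by
    induction k with
    | zero =>
      have := hS.comp_hilbertSchmidt ht P (fun n => a n) ha.le φ hφ fun x n => by
        rw [hP, analysis_apply, smul_apply, enorm_smul, mul_pow]
        have h1 : ‖(((a n ^ (1 / 2 : ℝ) : ℝ≥0) : ℝ) : 𝕜)‖ₑ = ((a n ^ (1 / 2 : ℝ) : ℝ≥0) : ℝ≥0∞) := by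
          rw [← ofReal_norm, RCLike.norm_ofReal, NNReal.abs_eq, ENNReal.ofReal_coe_nnreal]
        rw [h1, hb2]
      simpa using! this
    | succ k ih =>
      have hk : (0 : ℝ) ≤ k * σ := by positivity
      have := ih.comp_diag (by linarith) hσ0 hσ1 (fun n => a n ^ σ) hc (fun n => a n) ha.le
        fun n => (ENNReal.coe_rpow_of_nonneg _ hσ0).le
      rw [← ContinuousLinearMap.comp_assoc, ← ContinuousLinearMap.mul_def, ← pow_succ'] at this
      convert this using 1
      push_cast
      ring
  obtain ⟨B, hB, hBsum⟩ := exists_synthesis y hy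
  have hpow : ∀ (k : ℕ) (x : EllTwo 𝕜 ℕ) (n : ℕ),
      (diag (𝕜 := 𝕜) (fun n => a n ^ σ) hc ^ k) x n = ((((a n ^ σ) ^ k : ℝ≥0) : ℝ) : 𝕜) * x n :=
    fun k x n => by
    induction k with
    | zero => simp
    | succ k ih =>
      rw [pow_succ', mul_apply_eq_comp, diag_apply, ih, pow_succ']
      push_cast
      ring
  have hfinal := ((hiter N).comp_contraction hB).smul c
  have e1 : t + 1 / 2 + N * σ = t + τ := by
    rw [hσ]
    field_simp
    ring
  rw [e1] at hfinal
  convert hfinal using 1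
  ext1 x
  change ((c : ℝ) : 𝕜) • R (S x) = ((c : ℝ) : 𝕜) • B _
  congr 1
  refine (hR (S x)).unique ?_
  convert! hBsum _ using 2 with n
  change _ = ((diag (𝕜 := 𝕜) (fun n => a n ^ σ) hc ^ N) (P (S x))) n • y n
  have e2 : a n ^ τ = (a n ^ σ) ^ N * a n ^ (1 / 2 : ℝ) := by
    rw [← NNReal.rpow_natCast, ← NNReal.rpow_mul,
      ← NNReal.rpow_add_of_nonneg _ (by positivity) (by norm_num)]
    congr 1
    rw [hσ]
    field_simp
    ring
  rw [hpow, hP, analysis_apply, e2, smul_apply, smul_eq_mul, ← mul_assoc]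
  push_cast
  rfl

end DiagFactor

/-! ### Singular numbers of a diagonal operator. -/

section SingularNumbers

variable {𝕜 : Type u} [RCLike 𝕜] {ι : Type w} {d : ι → ℝ≥0} (hd : ∀ i, d i ≤ 1)

theorem adjoint_diag_diag_apply (x : EllTwo 𝕜 ι) (k : ι) :
    ContinuousLinearMap.adjoint (diag d hd) (diag d hd x) k = ((d k : ℝ) : 𝕜) ^ 2 * x k := by
  classical
  have h := ContinuousLinearMap.adjoint_inner_right (diag d hd) (lp.single 2 k 1 : EllTwo 𝕜 ι)
    (diag d hd x)
  rw [lp.inner_single_left, lp.inner_eq_tsum, tsum_eq_single k] at h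
  · simp only [diag_apply, lp.single_apply_self] at h
    simp only [RCLike.inner_apply, map_one, mul_one, RCLike.conj_ofReal] at h
    rw [h]
    ring
  · intro j hj
    rw [diag_apply, lp.single_apply_ne _ _ _ hj]
    simp

theorem finite_setOf_le {d : ι → ℝ≥0} (h0 : Tendsto d cofinite (𝓝 0)) {c : ℝ} (hc : 0 < c) :
    {k | c ≤ d k}.Finite := by
  have := h0.eventually (Iio_mem_nhds (show (0 : ℝ≥0) < c.toNNReal by simpa using hc))
  refine Set.Finite.subset this fun k hk hlt => ?_
  have h2 : ((d k : ℝ≥0) : ℝ) < c.toNNReal := by exact_mod_cast hlt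
  rw [Real.coe_toNNReal _ hc.le] at h2
  exact absurd hk (not_le.2 h2)

/-- Since `D* D` multiplies coordinates by `d_k²`, an eigenvector with eigenvalue `t²`, `t ≥ c`, is
supported where `d_k = t`. Thus `n + 1` independent vectors live on the finite set `{k | c ≤ d k}`,
which therefore has at least `n + 1` elements. -/
theorem exists_card_le_of_eigenvectors (h0 : Tendsto d cofinite (𝓝 0)) {c : ℝ} (hc : 0 < c) {n : ℕ}
    {e : Fin (n + 1) → EllTwo 𝕜 ι} (he : Orthonormal 𝕜 e)
    (heig : ∀ i, ∃ t : ℝ, c ≤ t ∧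
      (ContinuousLinearMap.adjoint (diag d hd)) (diag d hd (e i)) = ((t ^ 2 : ℝ) : 𝕜) • e i) :
    ∃ F : Finset ι, F.card = n + 1 ∧ ∀ k ∈ F, c ≤ d k := by
  have hfin := finite_setOf_le h0 hc
  set K := hfin.toFinset with hK
  have hzero : ∀ i, ∀ k ∉ K, e i k = 0 := fun i k hk => by
    obtain ⟨t, ht, hte⟩ := heig i
    have h1 := congrArg (fun x : EllTwo 𝕜 ι => x k) hte
    simp only [adjoint_diag_diag_apply, lp.coeFn_smul, Pi.smul_apply, smul_eq_mul] at h1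
    by_contra hne
    have h2 := mul_right_cancel₀ hne h1
    have h3 : ((d k : ℝ)) ^ 2 = t ^ 2 := by exact_mod_cast h2
    have h4 : (d k : ℝ) = t := (pow_left_inj₀ (d k).coe_nonneg (hc.le.trans ht) two_ne_zero).1 h3
    exact hk (hfin.mem_toFinset.2 (ht.trans_eq h4.symm))
  have hli : LinearIndependent 𝕜 fun i (k : K) => e i k := by
    rw [Fintype.linearIndependent_iff]
    intro g hg
    refine Fintype.linearIndependent_iff.1 he.linearIndependent g ?_
    ext k
    rw [lp.coeFn_sum, Finset.sum_apply]
    by_cases hk : k ∈ K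
    · simpa using congrFun hg ⟨k, hk⟩
    · simp [hzero _ k hk]
  have hcard := hli.fintype_card_le_finrank
  rw [Module.finrank_fintype_fun_eq_card, Fintype.card_fin, Fintype.card_coe] at hcard
  obtain ⟨F, hF, hFc⟩ := Finset.exists_subset_card_eq hcard
  exact ⟨F, hFc, fun k hk => hfin.mem_toFinset.1 (hF hk)⟩

theorem singularNumber_nonneg {H : Type w} [NormedAddCommGroup H] [InnerProductSpace 𝕜 H]
    [CompleteSpace H] (U : H →L[𝕜] H) (n : ℕ) : 0 ≤ singularNumber U n :=
  Real.sSup_nonneg fun _ hc => hc.1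

theorem exists_card_singularNumber_le (h0 : Tendsto d cofinite (𝓝 0)) {n : ℕ}
    (hn : 0 < singularNumber (diag (𝕜 := 𝕜) d hd) n) :
    ∃ F : Finset ι, F.card = n + 1 ∧ ∀ k ∈ F, singularNumber (diag (𝕜 := 𝕜) d hd) n ≤ d k := by
  set σ := singularNumber (diag (𝕜 := 𝕜) d hd) n with hσ
  have hfin := finite_setOf_le h0 (half_pos hn)
  -- The supremum `σ` need not be known to be attained. Only finitely many entries are at least `σ /
  -- 2`, so some `c < σ` lies above all entries smaller than `σ`; entries at least `c` are then at
  -- least `σ`.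
  have hev : ∀ᶠ c in 𝓝[<] σ, ∀ k ∈ {k | σ / 2 ≤ d k}, (d k : ℝ) < σ → (d k : ℝ) < c := by
    rw [hfin.eventually_all]
    intro k _
    by_cases hk : (d k : ℝ) < σ
    · filter_upwards [Ioo_mem_nhdsLT hk] with c hc _ using hc.1
    · exact Eventually.of_forall fun c h => absurd h hk
  obtain ⟨c, hc, hchalf, hcσ⟩ := (hev.and (Ioo_mem_nhdsLT (half_lt_self hn))).exists
  have hne : {c : ℝ | 0 ≤ c ∧ ∃ e : Fin (n + 1) → EllTwo 𝕜 ι, Orthonormal 𝕜 e ∧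
      ∀ i, ∃ t : ℝ, c ≤ t ∧ (ContinuousLinearMap.adjoint (diag d hd)) (diag d hd (e i)) =
        ((t ^ 2 : ℝ) : 𝕜) • e i}.Nonempty := by
    by_contra hemp
    rw [Set.not_nonempty_iff_eq_empty] at hemp
    rw [hσ, singularNumber, hemp, Real.sSup_empty] at hn
    exact hn.false
  obtain ⟨c', ⟨-, e, he, heig⟩, hcc'⟩ := exists_lt_of_lt_csSup hne hcσ
  have hc0 : 0 < c := (half_pos hn).trans hchalf
  obtain ⟨F, hF, hFd⟩ := exists_card_le_of_eigenvectors hd h0 (hc0.trans hcc') he heig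
  refine ⟨F, hF, fun k hk => ?_⟩
  by_contra hlt
  have h1 := hFd k hk
  have h2 := hc k (by change σ / 2 ≤ d k; linarith) (not_le.1 hlt)
  linarith

/-- The nonzero singular numbers of a diagonal operator are dominated by distinct diagonal
entries. -/
theorem exists_injective_singularNumber_le (h0 : Tendsto d cofinite (𝓝 0)) :
    ∃ k : {n // 0 < singularNumber (diag (𝕜 := 𝕜) d hd) n} → ι, Function.Injective k ∧
      ∀ n, singularNumber (diag (𝕜 := 𝕜) d hd) n.1 ≤ d (k n) := by
  classical
  choose F hFc hF using
    fun n : {n // 0 < singularNumber (diag (𝕜 := 𝕜) d hd) n} => exists_card_singularNumber_le hd h0 n.2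
  -- Hall's condition: a finite set of indices with maximum `n` has at most `n + 1` elements, and `F
  -- n` alone has that many.
  obtain ⟨k, hk, hkF⟩ := (Finset.all_card_le_biUnion_card_iff_exists_injective F).1 fun s => by
    obtain rfl | hs := s.eq_empty_or_nonempty
    · simp
    obtain ⟨n, hn, hmax⟩ := s.exists_max_image (fun n => n.1) hs
    calc s.card = (s.image Subtype.val).card :=
          (Finset.card_image_of_injective _ Subtype.val_injective).symm
      _ ≤ (Finset.range (n.1 + 1)).card := Finset.card_le_card fun j hj => by
          obtain ⟨i, hi, rfl⟩ := Finset.mem_image.1 hj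
          exact Finset.mem_range.2 (Nat.lt_succ_of_le (hmax i hi))
      _ = (F n).card := by rw [Finset.card_range, hFc]
      _ ≤ _ := Finset.card_le_card (Finset.subset_biUnion_of_mem F hn)
  exact ⟨k, hk, fun n => hF n _ (hkF n)⟩

theorem sigma_diag_le_one (h0 : Tendsto d cofinite (𝓝 0)) {z : ι → ℝ≥0∞} (hz : ∑' i, z i ≤ 1)
    {t : ℝ} (ht : 0 ≤ t) (hdz : ∀ i, (d i : ℝ≥0∞) ≤ z i ^ t) {s : ℝ≥0∞}
    (hs : s⁻¹ = ENNReal.ofReal t) : sigma s (diag (𝕜 := 𝕜) d hd) ≤ 1 := by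
  set σ := singularNumber (diag (𝕜 := 𝕜) d hd) with hσ
  obtain ⟨k, hk, hkd⟩ : ∃ k : {n // 0 < σ n} → ι, Function.Injective k ∧ ∀ n, σ n.1 ≤ d (k n) :=
    exists_injective_singularNumber_le hd h0
  have henorm : ∀ n : {n // 0 < σ n}, ‖σ n‖ₑ ≤ d (k n) := fun n => by
    rw [Real.enorm_of_nonneg n.2.le]
    exact (ENNReal.ofReal_le_ofReal (hkd n)).trans_eq ENNReal.ofReal_coe_nnreal
  have hzero : ∀ n, ¬ 0 < σ n → σ n = 0 := fun n hn =>
    le_antisymm (not_lt.1 hn) (singularNumber_nonneg _ n)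
  rw [sigma, ellNorm, ← hσ]
  split_ifs with hinf
  · refine iSup_le fun n => ?_
    by_cases hn : 0 < σ n
    · exact (henorm ⟨n, hn⟩).trans (by exact_mod_cast hd _)
    · simp [hzero n hn]
  · have ht0 : 0 < t := by
      refine ht.lt_of_ne fun h => hinf ?_
      rw [← h, ENNReal.ofReal_zero] at hs
      exact ENNReal.inv_eq_zero.1 hs
    have hsr : s.toReal = 1 / t := by
      rw [← inv_inv s, hs, ENNReal.toReal_inv, ENNReal.toReal_ofReal ht, one_div]
    rw [hsr]
    refine ENNReal.rpow_le_one ?_ (by positivity)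
    have hsupp : ∑' n : {n // 0 < σ n}, ‖σ n‖ₑ ^ (1 / t) = ∑' n, ‖σ n‖ₑ ^ (1 / t) :=
      tsum_subtype_eq_of_support_subset (f := fun n => ‖σ n‖ₑ ^ (1 / t)) (s := {n | 0 < σ n})
        fun n hn => by
        by_contra hcon
        refine hn ?_
        change ‖σ n‖ₑ ^ (1 / t) = 0
        rw [hzero n hcon, enorm_zero, ENNReal.zero_rpow_of_pos (by positivity)]
    rw [← hsupp]
    calc _ ≤ ∑' n, z (k n) := ENNReal.tsum_le_tsum fun n => by
          calc ‖σ n‖ₑ ^ (1 / t) ≤ (z (k n) ^ t) ^ (1 / t) :=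
                ENNReal.rpow_le_rpow ((henorm n).trans (hdz _)) (by positivity)
            _ = z (k n) := by rw [one_div, ENNReal.rpow_rpow_inv ht0.ne']
      _ ≤ ∑' i, z i := ENNReal.tsum_comp_le_tsum_of_injective hk z
      _ ≤ 1 := hz

end SingularNumbers

/-! ### From nuclear representations to Schatten factorizations of the chain. -/

section Main

variable {𝕜 : Type u} [RCLike 𝕜] {X Y : Type v}
  [NormedAddCommGroup X] [NormedSpace 𝕜 X] [NormedAddCommGroup Y] [NormedSpace 𝕜 Y]

theorem DiagFactor.schatten {t : ℝ} {C : ℝ≥0} {S : X →L[𝕜] Y} (h : DiagFactor t C S) (ht : 0 ≤ t)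
    {s : ℝ≥0∞} (hs : s⁻¹ = ENNReal.ofReal t) :
    FactorsThroughSchatten s S ∧ gammaSchatten s S ≤ C := by
  obtain ⟨ι, d, hd, z, A, B, hA, hB, h0, hz, hdz, rfl⟩ := h
  have hσ := sigma_diag_le_one (𝕜 := 𝕜) hd h0 hz ht hdz hs
  have hU : IsSchatten s (diag (𝕜 := 𝕜) d hd) :=
    ⟨isCompactOperator_diag hd h0, hσ.trans_lt ENNReal.one_lt_top⟩
  have hfac : ((C : ℝ) : 𝕜) • (B ∘L diag d hd ∘L A) =
      B ∘L diag d hd ∘L (((C : ℝ) : 𝕜) • A) := by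
    ext x
    simp only [smul_apply, ContinuousLinearMap.comp_apply, map_smul]
  refine ⟨⟨EllTwo 𝕜 ι, inferInstance, inferInstance, inferInstance, _, _, _, hU, hfac⟩, ?_⟩
  have hle : gammaSchatten s (((C : ℝ) : 𝕜) • (B ∘L diag d hd ∘L A)) ≤
      ‖((C : ℝ) : 𝕜) • A‖ₑ * sigma s (diag (𝕜 := 𝕜) d hd) * ‖B‖ₑ :=
    sInf_le ⟨EllTwo 𝕜 ι, inferInstance, inferInstance, inferInstance, _, _, _, hU, hfac, rfl⟩
  refine hle.trans ?_
  have hA' : ‖((C : ℝ) : 𝕜) • A‖ₑ ≤ C := by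
    rw [← ofReal_norm, norm_smul, RCLike.norm_ofReal, NNReal.abs_eq]
    exact (ENNReal.ofReal_le_ofReal (mul_le_of_le_one_right C.coe_nonneg hA)).trans_eq
      ENNReal.ofReal_coe_nnreal
  have hB' : ‖B‖ₑ ≤ 1 := by
    rw [← ofReal_norm]
    exact ENNReal.ofReal_le_one.2 hB
  calc _ ≤ (C : ℝ≥0∞) * 1 * 1 := by gcongr
    _ = C := by simp

theorem ellNorm_const_mul {p : ℝ≥0∞} (hp : 0 < p) (hp' : p ≠ ∞) (c : 𝕜) (a : ℕ → 𝕜) :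
    ellNorm p (fun n => c * a n) = ‖c‖ₑ * ellNorm p a := by
  have hpr := ENNReal.toReal_pos hp.ne' hp'
  rw [ellNorm, ellNorm, if_neg hp', if_neg hp']
  simp_rw [enorm_mul, ENNReal.mul_rpow_of_nonneg _ _ hpr.le]
  rw [ENNReal.tsum_mul_left, ENNReal.mul_rpow_of_nonneg _ _ (by positivity), one_div,
    ENNReal.rpow_rpow_inv hpr.ne']

theorem IsNuclear.nu_lt_top {s : ℝ≥0∞} (hs : 0 < s) (hs' : s ≠ ∞) {T : X →L[𝕜] Y}
    (hT : IsNuclear s T) : nu s T < ∞ := by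
  obtain ⟨a, x', y, ⟨hx', hsum⟩, ha, hy⟩ := hT
  obtain ⟨r, hr⟩ : ∃ r : ℝ≥0, (r : ℝ≥0∞) = weakEllTwoNorm 𝕜 y + 1 :=
    ⟨(weakEllTwoNorm 𝕜 y + 1).toNNReal,
      ENNReal.coe_toNNReal (ENNReal.add_lt_top.2 ⟨hy, ENNReal.one_lt_top⟩).ne⟩
  have hr1 : (1 : ℝ≥0∞) ≤ r := hr ▸ le_add_self
  have hr0 : r ≠ 0 := by
    rintro rfl
    simp at hr1
  have hrK : ((r : ℝ) : 𝕜) ≠ 0 := by exact_mod_cast hr0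
  have hrn : ‖((r : ℝ) : 𝕜)‖ₑ = r := by simp [← ofReal_norm]
  refine lt_of_le_of_lt (sInf_le ⟨fun n => ((r : ℝ) : 𝕜) * a n, x',
    fun n => (((r : ℝ) : 𝕜)⁻¹) • y n, ⟨hx', fun x => ?_⟩, ?_, rfl⟩) ?_
  · convert! hsum x using 2 with n
    rw [smul_smul]
    congr 1
    field_simp
  · refine iSup₂_le fun g hg => ?_
    simp_rw [map_smul, smul_eq_mul]
    rw [ellNorm_const_mul (by norm_num) (by norm_num), enorm_inv hrK, hrn]
    have : ellNorm 2 (fun n => g (y n)) ≤ r :=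
      (le_iSup₂ (f := fun (φ : StrongDual 𝕜 Y) (_ : ‖φ‖ ≤ 1) => ellNorm 2 fun n => φ (y n)) g
        hg).trans (hr ▸ le_self_add)
    calc (r : ℝ≥0∞)⁻¹ * ellNorm 2 (fun n => g (y n)) ≤ (r : ℝ≥0∞)⁻¹ * r := by gcongr
      _ ≤ 1 := ENNReal.inv_mul_le_one _
  · rw [ellNorm_const_mul hs hs', hrn]
    exact ENNReal.mul_lt_top ENNReal.coe_lt_top ha

/-- The phases of the coefficients move into the functionals, and the moduli are divided by `C`;
strictness of `nu s T < C` makes the normalized sum strictly less than one. -/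
theorem nuclearRep_of_nu_lt {s : ℝ≥0∞} (hs : 0 < s) (hs' : s ≠ ∞) {T : X →L[𝕜] Y} {C : ℝ≥0}
    (h : nu s T < C) : NuclearRep (s⁻¹).toReal C T := by
  obtain ⟨_, ⟨a, x', y, ⟨hx', hsum⟩, hy, rfl⟩, ha⟩ := sInf_lt_iff.1 h
  have hp := ENNReal.toReal_pos hs.ne' hs'
  set p := s.toReal with hpdef
  have hC : C ≠ 0 := by
    rintro rfl
    simp at ha
  have hCK : ((C : ℝ) : 𝕜) ≠ 0 := by exact_mod_cast hC
  rw [ellNorm, if_neg hs', ← hpdef, one_div, ENNReal.rpow_inv_lt_iff hp] at ha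
  refine ⟨fun n => (‖a n‖₊ / C) ^ p, fun n => (a n / ((‖a n‖ : ℝ) : 𝕜)) • x' n, y,
    ((C : ℝ) : 𝕜)⁻¹ • T, ?_, fun n => ?_, fun g hg => ?_, fun x => ?_, ?_⟩
  · have : ∀ n, (((‖a n‖₊ / C) ^ p : ℝ≥0) : ℝ≥0∞) = ‖a n‖ₑ ^ p * ((C : ℝ≥0∞) ^ p)⁻¹ := fun n => by
      rw [ENNReal.coe_rpow_of_nonneg _ hp.le, ENNReal.coe_div hC, ENNReal.div_rpow_of_nonneg _ _ hp.le,
        div_eq_mul_inv, enorm_eq_nnnorm]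
    simp_rw [this]
    rw [ENNReal.tsum_mul_right, ← div_eq_mul_inv]
    refine ENNReal.div_lt_of_lt_mul ?_
    rwa [one_mul]
  · rw [norm_smul, norm_div, RCLike.norm_ofReal, abs_norm]
    exact mul_le_one₀ (div_self_le_one _) (norm_nonneg _) (hx' n)
  · have h1 := (le_iSup₂ (f := fun (φ : StrongDual 𝕜 Y) (_ : ‖φ‖ ≤ 1) => ellNorm 2 fun n => φ (y n))
      g hg).trans hy
    rw [ellNorm, if_neg (by norm_num), ENNReal.toReal_ofNat, one_div,
      ENNReal.rpow_inv_le_iff (by norm_num), ENNReal.one_rpow] at h1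
    simpa using! h1
  · convert! (hsum x).const_smul (((C : ℝ) : 𝕜)⁻¹) using 2 with n
    rw [ENNReal.toReal_inv, NNReal.rpow_rpow_inv hp.ne', smul_smul]
    congr 1
    rw [smul_apply, smul_eq_mul, NNReal.coe_div, coe_nnnorm]
    by_cases h0 : a n = 0
    · simp [h0]
    · have h0' : ((‖a n‖ : ℝ) : 𝕜) ≠ 0 := by exact_mod_cast norm_ne_zero_iff.2 h0
      push_cast
      field_simp
  · rw [smul_smul, mul_inv_cancel₀ hCK, one_smul]

/-- The induction effectively starts at the first operator: the empty product is the identity of a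
Banach space and has no such factorization to build on. -/
theorem diagFactor_chainProd {m : ℕ} {X : Fin (m + 1) → Type v} [∀ k, NormedAddCommGroup (X k)]
    [∀ k, NormedSpace 𝕜 (X k)] [∀ k, CompleteSpace (X k)]
    {T : ∀ k : Fin m, X k.castSucc →L[𝕜] X k.succ} {τ : Fin m → ℝ} (hτ : ∀ k, 1 / 2 ≤ τ k)
    {C : Fin m → ℝ≥0} (hT : ∀ k, NuclearRep (τ k) (C k) (T k)) (k : Fin (m + 1)) :
    k ≠ 0 → 0 ≤ ∑ j with j.castSucc < k, τ j - 1 / 2 ∧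
      DiagFactor (∑ j with j.castSucc < k, τ j - 1 / 2) (∏ j with j.castSucc < k, C j)
        (chainProd T k) := by
  induction k using Fin.induction with
  | zero => exact fun h => absurd rfl h
  | succ k ih =>
    intro _
    have hins : (Finset.univ.filter fun j : Fin m => j.castSucc < k.succ) =
        insert k (Finset.univ.filter fun j : Fin m => j.castSucc < k.castSucc) := by
      ext j
      simp only [Finset.mem_filter, Finset.mem_univ, true_and, Finset.mem_insert, Fin.lt_def,
        Fin.ext_iff, Fin.val_castSucc, Fin.val_succ]
      omega
    have hk : k ∉ Finset.univ.filter fun j : Fin m => j.castSucc < k.castSucc := by simp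
    rw [hins, Finset.sum_insert hk, Finset.prod_insert hk]
    have hchain : chainProd T k.succ = (T k).comp (chainProd T k.castSucc) := rfl
    rw [hchain]
    by_cases h0 : k.castSucc = 0
    · cases m with
      | zero => exact k.elim0
      | succ m =>
        obtain rfl : k = 0 := Fin.castSucc_eq_zero_iff.1 h0
        have hemp : (Finset.univ.filter fun j : Fin (m + 1) => j.castSucc < (0 : Fin (m + 1)).castSucc)
            = ∅ := by
          ext j
          simp
        rw [hemp, Finset.sum_empty, Finset.prod_empty, add_zero, mul_one]
        exact ⟨by linarith [hτ 0], (hT 0).diagFactor (hτ 0)⟩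
    · obtain ⟨h1, h2⟩ := ih h0
      refine ⟨by linarith [hτ k], ?_⟩
      convert (hT k).comp_diagFactor h2 h1 (hτ k) using 1
      ring

end Main

end SchattenFactorization
end

open Filter Topology in
open scoped NNReal in
theorem mainTheorem6 {𝕜 : Type u} [RCLike 𝕜] (m : ℕ) (hm : 1 ≤ m)
    (X : Fin (m + 1) → Type v) [∀ k, NormedAddCommGroup (X k)] [∀ k, NormedSpace 𝕜 (X k)]
    [∀ k, CompleteSpace (X k)]
    (sk : Fin m → ℝ≥0∞) (hsk : ∀ k, 0 < sk k ∧ sk k ≤ 2)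
    (T : ∀ k : Fin m, X k.castSucc →L[𝕜] X k.succ)
    (hT : ∀ k, SchattenFactorization.IsNuclear (sk k) (T k))
    (s : ℝ≥0∞) (hs : s⁻¹ + 2⁻¹ = ∑ k, (sk k)⁻¹) :
    SchattenFactorization.FactorsThroughSchatten s
        (SchattenFactorization.chainProd T (Fin.last m)) ∧
      SchattenFactorization.gammaSchatten s
          (SchattenFactorization.chainProd T (Fin.last m)) ≤
        ∏ k, SchattenFactorization.nu (sk k) (T k) := by
  have hsk' : ∀ k, sk k ≠ ∞ := fun k => ((hsk k).2.trans_lt (by norm_num)).ne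
  have hinv : ∀ k, (sk k)⁻¹ ≠ ∞ := fun k => ENNReal.inv_ne_top.2 (hsk k).1.ne'
  have hτ : ∀ k, 1 / 2 ≤ ((sk k)⁻¹).toReal := fun k => by
    have := ENNReal.toReal_mono (hinv k) (ENNReal.inv_le_inv.2 (hsk k).2)
    simpa using this
  have hsinv : s⁻¹ ≠ ∞ := fun h => by
    rw [h, top_add] at hs
    exact ENNReal.sum_ne_top.2 (fun k _ => hinv k) hs.symm
  have hnu : ∀ k, SchattenFactorization.nu (sk k) (T k) ≠ ∞ := fun k =>
    ((hT k).nu_lt_top (hsk k).1 (hsk' k)).ne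
  have hlast : (Finset.univ.filter fun j : Fin m => j.castSucc < Fin.last m) = Finset.univ := by
    ext j
    simp [Fin.castSucc_lt_last]
  have hs' : s⁻¹ = ENNReal.ofReal (∑ k, ((sk k)⁻¹).toReal - 1 / 2) := by
    rw [← ENNReal.toReal_sum fun k _ => hinv k, ← hs, ENNReal.toReal_add hsinv (by norm_num)]
    rw [ENNReal.toReal_inv 2, ENNReal.toReal_ofNat, one_div, add_sub_cancel_right,
      ENNReal.ofReal_toReal hsinv]
  -- The infima `nu` need not be attained, so each is enlarged by `ε`; the product of the constants
  -- is continuous in `ε`, and `ε → 0` gives the sharp bound.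
  have key : ∀ ε : ℝ≥0, 0 < ε →
      SchattenFactorization.FactorsThroughSchatten s
          (SchattenFactorization.chainProd T (Fin.last m)) ∧
        SchattenFactorization.gammaSchatten s
            (SchattenFactorization.chainProd T (Fin.last m)) ≤
          ((∏ k, ((SchattenFactorization.nu (sk k) (T k)).toNNReal + ε) : ℝ≥0) : ℝ≥0∞) := by
    intro ε hε
    obtain ⟨h1, h2⟩ := SchattenFactorization.diagFactor_chainProd hτ
      (C := fun k => (SchattenFactorization.nu (sk k) (T k)).toNNReal + ε)
      (fun k => SchattenFactorization.nuclearRep_of_nu_lt (hsk k).1 (hsk' k) (by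
        rw [ENNReal.coe_add, ENNReal.coe_toNNReal (hnu k)]
        exact ENNReal.lt_add_right (hnu k) (by exact_mod_cast hε.ne')))
      (Fin.last m) (by
        rw [Ne, Fin.ext_iff]
        simp
        omega)
    rw [hlast] at h1 h2
    exact h2.schatten h1 hs'
  refine ⟨(key 1 one_pos).1, ?_⟩
  have hprod : ∏ k, SchattenFactorization.nu (sk k) (T k) =
      ((∏ k, ((SchattenFactorization.nu (sk k) (T k)).toNNReal + 0) : ℝ≥0) : ℝ≥0∞) := by
    rw [ENNReal.ofNNReal_finsetProd]
    exact Finset.prod_congr rfl fun k _ => by rw [add_zero, ENNReal.coe_toNNReal (hnu k)]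
  rw [hprod]
  have hcont : Continuous fun ε : ℝ≥0 =>
      ((∏ k, ((SchattenFactorization.nu (sk k) (T k)).toNNReal + ε) : ℝ≥0) : ℝ≥0∞) :=
    ENNReal.continuous_coe.comp (by fun_prop)
  refine ge_of_tendsto ((hcont.tendsto 0).mono_left nhdsWithin_le_nhds : Tendsto _ (𝓝[>] (0 : ℝ≥0)) _) ?_
  filter_upwards [self_mem_nhdsWithin] with ε hε using (key ε hε).2
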